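/- Let $d\ge 1$, $m\ge 1$, let $\Omega\subset\mathbb{R}^d$ be a bounded open set (for instance a bounded Lipschitz domain) and let $s>1+d/2$ be real. Let $H^s(\Omega;\mathbb{R}^m)$ be the space of restrictions to $\Omega$ of elements of $H^s(\mathbb{R}^d)$, with the norm $\|f\|_{H^s(\Omega)}=\inf\{\|U\|_{H^s(\mathbb{R}^d)}: U|_\Omega=f\}$, where $\|U\|_{H^s(\mathbb{R}^d)}=\|(1+|\xi|^2)^{s/2}\widehat U\|_{L^2}$ and $\widehat U(\xi)=\int_{\mathbb{R}^d} e^{-2\pi i x\cdot\xi}\,U(x)\,dx$. For centers $\mu_1,\dots,\mu_K\in\Omega$, $K\ge1$, let $h_K=\sup_{x\in\Omega}\min_k|x-\mu_k|$ be the fill distance and $q_K=\frac12\min_{i\ne j}|\mu_i-\mu_j|$ the separation radius (with $q_1=\infty$). For weights $w_k>0$, symmetric positive definite matrices $\Sigma_k\in\mathbb{R}^{d\times d}$ and amplitudes $a_k\in\mathbb{R}^m$ let $$\varphi_k(x)=\exp\!\bigl(-\tfrac12(x-\mu_k)^\top\Sigma_k^{-1}(x-\mu_k)\bigr),\qquad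 \psi_k=\frac{w_k\varphi_k}{\sum_{j=1}^K w_j\varphi_j},\qquad f_{\mathrm{prim}}=\sum_{k=1}^K\psi_k\,a_k .$$ Let $\rho\in[0,\infty)$, $0<w_-\le w_+<\infty$ and $0<c_\Sigma\le C_\Sigma<\infty$. Then there is a constant $C$, depending only on $\Omega,d,m,s,\rho,w_\pm,c_\Sigma,C_\Sigma$, such that the following holds. Every $f\in H^s(\Omega;\mathbb{R}^m)$ has a continuous representative on $\Omega$, so that the values $f(\mu_k)$ are well defined; and for every $K\ge1$ and all centers $\mu_k\in\Omega$, weights $w_k$ and symmetric matrices $\Sigma_k$ ($1\le k\le K$) with $$h_K\le\rho\,q_K,\qquad w_-\le w_k\le w_+,\qquad c_\Sigma h_K^2 I\preceq\Sigma_k\preceq C_\Sigma h_K^2 I,$$ the scaffold $f_{\mathrm{prim}}$ with $a_k=f(\mu_k)$ satisfies $$\|f-f_{\mathrm{prim}}\|_{L^2(\Omega)}\le C\,K^{-1/d}\,\|f\|_{H^s(\Omega)}.$$ -/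

import Mathlib

open MeasureTheory TemperedDistribution
open scoped ENNReal NNReal SchwartzMap

noncomputable section

/-! ## Sobolev spaces on an open set

`H^s(Ω; ℝ^m)` for real `s ≥ 0` is the space of restrictions to `Ω` of elements of
`H^s(ℝ^d; ℂ^m)`, with the quotient norm; the latter is the Bessel potential space of Mathlib. -/

/-- `U ∈ L²(ℝ^d; ℂ^m)` extends `f` from `Ω`, it lies in `H^s(ℝ^d; ℂ^m)`, and `V` is its Bessel
potential `𝓕⁻¹ ((1 + |ξ|²)^{s/2} 𝓕 U) ∈ L²`; hence the `H^s`-norm of `U` is the `L²`-norm of `V`. -/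
structure IsSobolevExtension {d m : ℕ} (Ω : Set (EuclideanSpace ℝ (Fin d))) (s : ℝ)
    (f : EuclideanSpace ℝ (Fin d) → EuclideanSpace ℝ (Fin m))
    (U V : Lp (EuclideanSpace ℂ (Fin m)) 2 (volume : Measure (EuclideanSpace ℝ (Fin d)))) :
    Prop where
  eq_on : ∀ᵐ x ∂(volume.restrict Ω), ∀ i, U x i = (f x i : ℂ)
  bessel : besselPotential (EuclideanSpace ℝ (Fin d)) (EuclideanSpace ℂ (Fin m)) s
      (U : 𝓢'(EuclideanSpace ℝ (Fin d), EuclideanSpace ℂ (Fin m))) = V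

/-- `f ∈ H^s(Ω; ℝ^m)`. Only the values of `f` almost everywhere on `Ω` matter. -/
def MemSobolevOn {d m : ℕ} (Ω : Set (EuclideanSpace ℝ (Fin d))) (s : ℝ)
    (f : EuclideanSpace ℝ (Fin d) → EuclideanSpace ℝ (Fin m)) : Prop :=
  ∃ U V, IsSobolevExtension Ω s f U V

/-- The norm of `H^s(Ω; ℝ^m)`: the infimum of the `H^s(ℝ^d)`-norms of all extensions. -/
def sobolevENormOn {d m : ℕ} (Ω : Set (EuclideanSpace ℝ (Fin d))) (s : ℝ)
    (f : EuclideanSpace ℝ (Fin d) → EuclideanSpace ℝ (Fin m)) : ℝ≥0∞ :=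
  ⨅ (U) (V) (_ : IsSobolevExtension Ω s f U V), ‖V‖ₑ

/-- `g` is a continuous representative on `Ω` of the almost-everywhere class of `f`. -/
structure IsContinuousRep {d m : ℕ} (Ω : Set (EuclideanSpace ℝ (Fin d)))
    (f g : EuclideanSpace ℝ (Fin d) → EuclideanSpace ℝ (Fin m)) : Prop where
  continuousOn : ContinuousOn g Ω
  ae_eq : f =ᵐ[volume.restrict Ω] g

/-! ## Centers -/

/-- Fill distance `h = sup_{x ∈ Ω} min_k |x - μ_k|`. -/
def fillDistance {d K : ℕ} (Ω : Set (EuclideanSpace ℝ (Fin d)))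
    (μ : Fin K → EuclideanSpace ℝ (Fin d)) : ℝ≥0∞ :=
  ⨆ x ∈ Ω, ⨅ k, edist x (μ k)

/-- Separation radius `q = (1/2) min_{i ≠ j} |μ_i - μ_j|` (equal to `∞` for a single center). -/
def separationRadius {d K : ℕ} (μ : Fin K → EuclideanSpace ℝ (Fin d)) : ℝ≥0∞ :=
  (⨅ (i) (j) (_ : i ≠ j), edist (μ i) (μ j)) / 2

/-- The centers lie in `Ω` and satisfy `h ≤ ρ q`. -/
structure IsQuasiUniform {d K : ℕ} (Ω : Set (EuclideanSpace ℝ (Fin d))) (ρ : ℝ≥0)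
    (μ : Fin K → EuclideanSpace ℝ (Fin d)) : Prop where
  mem : ∀ k, μ k ∈ Ω
  fill_le : fillDistance Ω μ ≤ ρ * separationRadius μ

/-! ## The normalized Gaussian scaffold -/

/-- `exp (-(1/2) (x - μ)ᵀ S⁻¹ (x - μ))`. -/
def gaussianPrimitive {d : ℕ} (μ : EuclideanSpace ℝ (Fin d)) (S : Matrix (Fin d) (Fin d) ℝ)
    (x : EuclideanSpace ℝ (Fin d)) : ℝ :=
  Real.exp (-(1 / 2) * ((x - μ).ofLp ⬝ᵥ (S⁻¹.mulVec (x - μ).ofLp)))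

/-- `ψ_k = w_k φ_k / ∑_j w_j φ_j`. -/
def shepardWeight {d K : ℕ} (w : Fin K → ℝ) (μ : Fin K → EuclideanSpace ℝ (Fin d))
    (S : Fin K → Matrix (Fin d) (Fin d) ℝ) (k : Fin K) (x : EuclideanSpace ℝ (Fin d)) : ℝ :=
  w k * gaussianPrimitive (μ k) (S k) x / ∑ j, w j * gaussianPrimitive (μ j) (S j) x

/-- `f_prim = ∑_k ψ_k a_k`. -/
def scaffold {d m K : ℕ} (w : Fin K → ℝ) (μ : Fin K → EuclideanSpace ℝ (Fin d))
    (S : Fin K → Matrix (Fin d) (Fin d) ℝ) (a : Fin K → EuclideanSpace ℝ (Fin m))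
    (x : EuclideanSpace ℝ (Fin d)) : EuclideanSpace ℝ (Fin m) :=
  ∑ k, shepardWeight w μ S k x • a k

/-- `c h² I ≼ S ≼ C h² I` in the positive semidefinite order. -/
structure IsComparableToSq {d : ℕ} (c C h : ℝ) (S : Matrix (Fin d) (Fin d) ℝ) : Prop where
  lower : (S - (c * h ^ 2) • (1 : Matrix (Fin d) (Fin d) ℝ)).PosSemidef
  upper : ((C * h ^ 2) • (1 : Matrix (Fin d) (Fin d) ℝ) - S).PosSemidef

end

/-! Since `s > 1 + d/2`, Cauchy–Schwarz on the Fourier side makes `|ξ| |𝓕U|` integrable, so each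
extension `U` has a representative that is Lipschitz on all of `ℝ^d` with constant `L‖V‖`
(`exists_lipschitz_rep_of_besselPotential_eq`). No segment has to stay inside `Ω`, so its geometry
plays no role.

The `ψ_k` are nonnegative and sum to 1, so the error at `x` is at most `L‖V‖ ∑ ψ_k(x) |x - μ_k|`. A
center within `h` of `x` bounds the denominator of `ψ_k` below, and Gaussians of width about `h` on
separated centers have summable tails: the sum is `O(h)`
(`exists_sum_shepardWeight_mul_norm_sub_le`). Packing balls around the centers gives `h =
O(K^{-1/d})`. Finally, integrate the uniform bound over the bounded set `Ω` and take the infimum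
over extensions. -/

/-! ### Sobolev embedding into Lipschitz functions -/

section SobolevEmbedding

open FourierTransform
open scoped RealInnerProductSpace ContDiff

variable {E F : Type*} [NormedAddCommGroup E] [InnerProductSpace ℝ E] [FiniteDimensional ℝ E]
  [MeasurableSpace E] [BorelSpace E] [NormedAddCommGroup F]

theorem memLp_two_one_add_norm_sq_rpow {s : ℝ} (hs : Module.finrank ℝ E < 2 * s) :
    MemLp (fun x : E ↦ (1 + ‖x‖ ^ 2) ^ (-s / 2)) 2 := by
  have hm : AEStronglyMeasurable (fun x : E ↦ (1 + ‖x‖ ^ 2) ^ (-s / 2)) :=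
    Measurable.aestronglyMeasurable (by fun_prop)
  rw [memLp_two_iff_integrable_sq hm]
  refine (integrable_rpow_neg_one_add_norm_sq hs).congr (.of_forall fun x ↦ ?_)
  change _ = ((1 + ‖x‖ ^ 2) ^ (-s / 2)) ^ 2
  rw [← Real.rpow_mul_natCast (by positivity)]
  push_cast
  ring_nf

theorem norm_fourierChar_smul_sub_smul_le [NormedSpace ℂ F] (a b : ℝ) (v : F) :
    ‖Real.fourierChar a • v - Real.fourierChar b • v‖ ≤ 2 * Real.pi * |a - b| * ‖v‖ := by
  have h : Real.fourierChar a • v - Real.fourierChar b • v =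
      Real.fourierChar b • ((Complex.exp (.I * (2 * Real.pi * (a - b) : ℝ)) - 1) • v) := by
    rw [sub_smul, smul_sub, one_smul, ← sub_add_cancel a b, add_comm, AddChar.map_add_eq_mul,
      mul_smul]
    congr 2
    rw [add_comm, add_sub_cancel_right, Circle.smul_def, Real.fourierChar_apply, mul_comm]
  rw [h, Circle.norm_smul, norm_smul]
  gcongr
  refine Real.norm_exp_I_mul_ofReal_sub_one_le.trans_eq ?_
  rw [Real.norm_eq_abs, abs_mul, abs_of_pos Real.two_pi_pos]

theorem norm_fourierInv_sub_le [NormedSpace ℂ F] {v : E → F} (hv : Integrable v)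
    (hv' : Integrable fun ξ ↦ ‖ξ‖ * ‖v ξ‖) (x y : E) :
    ‖𝓕⁻ v x - 𝓕⁻ v y‖ ≤ 2 * Real.pi * (∫ ξ, ‖ξ‖ * ‖v ξ‖) * ‖x - y‖ := by
  have hint (z : E) : Integrable fun ξ ↦ Real.fourierChar ⟪ξ, z⟫ • v ξ := by
    simpa using! (Real.fourierIntegral_convergent_iff (μ := volume) (f := v) (-z)).2 hv
  rw [Real.fourierInv_eq, Real.fourierInv_eq, ← integral_sub (hint x) (hint y)]
  calc _ ≤ ∫ ξ, 2 * Real.pi * ‖x - y‖ * (‖ξ‖ * ‖v ξ‖) := by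
        refine norm_integral_le_of_norm_le (hv'.const_mul _) (.of_forall fun ξ ↦ ?_)
        refine (norm_fourierChar_smul_sub_smul_le _ _ _).trans ?_
        rw [← inner_sub_right, mul_assoc _ ‖x - y‖, ← mul_assoc ‖x - y‖, mul_comm ‖x - y‖,
          mul_assoc _ |_|]
        gcongr
        exact abs_real_inner_le_norm _ _
    _ = _ := by rw [integral_const_mul]; ring

theorem continuous_fourierInv_of_integrable [NormedSpace ℂ F] {v : E → F} (hv : Integrable v) :
    Continuous (𝓕⁻ v) :=
  VectorFourier.fourierIntegral_continuous Real.continuous_fourierChar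
    (L := -innerₗ E) (by simpa using! continuous_inner.neg) hv

theorem integral_fourierInv_smul_eq_of_integrable [NormedSpace ℂ F] [CompleteSpace F] {v : E → F}
    (hv : Integrable v) (φ : 𝓢(E, ℂ)) : ∫ ξ, 𝓕⁻ φ ξ • v ξ = ∫ x, φ x • 𝓕⁻ v x := by
  have := VectorFourier.integral_fourierIntegral_smul_eq_flip (L := -innerₗ E) (μ := volume)
    (ν := volume) (e := Real.fourierChar) Real.continuous_fourierChar
    (by simpa using! continuous_inner.neg) φ.integrable hv
  have hflip : (-innerₗ E).flip = -innerₗ E := by ext; simp [real_inner_comm]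
  rw [hflip] at this
  simpa [SchwartzMap.fourierInv_coe] using! this

/-- Both sides are locally integrable, so it suffices to test against smooth compactly supported
`g`; Fourier inversion on the test function transfers the hypothesis. -/
theorem ae_eq_fourierInv_of_fourier_eq [InnerProductSpace ℂ F] [CompleteSpace F]
    {U : Lp F 2 (volume : Measure E)} {v : E → F} (hv : Integrable v)
    (h : ∀ φ : 𝓢(E, ℂ), 𝓕 (U : 𝓢'(E, F)) φ = ∫ ξ, φ ξ • v ξ) : U =ᵐ[volume] 𝓕⁻ v := by
  refine ae_eq_of_integral_contDiff_smul_eq ((Lp.memLp U).locallyIntegrable one_le_two)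
    (continuous_fourierInv_of_integrable hv).locallyIntegrable fun g hg hgc ↦ ?_
  have h₁ : HasCompactSupport (Complex.ofRealCLM ∘ g) := hgc.comp_left rfl
  have h₂ : ContDiff ℝ ∞ (Complex.ofRealCLM ∘ g) := by fun_prop
  set χ : 𝓢(E, ℂ) := h₁.toSchwartzMap h₂
  have h₃ := h (𝓕⁻ χ)
  rw [integral_fourierInv_smul_eq_of_integrable hv, TemperedDistribution.fourier_apply,
    fourier_fourierInv_eq, Lp.toTemperedDistribution_apply] at h₃
  simpa [χ] using h₃

theorem exists_lipschitz_rep_of_besselPotential_eq [InnerProductSpace ℂ F] [CompleteSpace F]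
    {s : ℝ} (hs : 1 + (Module.finrank ℝ E : ℝ) / 2 < s) :
    ∃ L : ℝ, 0 ≤ L ∧ ∀ U V : Lp F 2 (volume : Measure E),
      besselPotential E F s (U : 𝓢'(E, F)) = V →
      ∃ u : E → F, Continuous u ∧ U =ᵐ[volume] u ∧ ∀ x y, ‖u x - u y‖ ≤ L * ‖V‖ * ‖x - y‖ := by
  set b : ℝ → E → ℝ := fun r x ↦ (1 + ‖x‖ ^ 2) ^ (-r / 2) with hb
  -- The weight of order `s` gives continuity; the one of order `s - 1` absorbs the factor `‖ξ‖ ≤ (1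
  -- + ‖ξ‖²)^{1/2}` and gives the Lipschitz bound. The latter is square integrable exactly because
  -- `2(s - 1) > d`.
  have hb0 : MemLp (b s) 2 := memLp_two_one_add_norm_sq_rpow (by linarith)
  have hb1 : MemLp (b (s - 1)) 2 := memLp_two_one_add_norm_sq_rpow (by linarith)
  refine ⟨2 * Real.pi * (∫ x, ‖b (s - 1) x‖ ^ (2 : ℝ)) ^ (1 / (2 : ℝ)), by positivity,
    fun U V hUV ↦ ?_⟩
  have hW : MemLp (⇑(𝓕 V : Lp F 2 (volume : Measure E))) 2 := Lp.memLp _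
  set W : E → F := ⇑(𝓕 V : Lp F 2 (volume : Measure E))
  have hv : Integrable fun ξ ↦ (b s ξ : ℂ) • W ξ := by
    simpa using! memLp_one_iff_integrable.1 (hW.smul (r := 1) hb0.ofReal)
  have hle (ξ : E) : ‖ξ‖ * ‖(b s ξ : ℂ) • W ξ‖ ≤ ‖b (s - 1) ξ‖ * ‖W ξ‖ := by
    rw [norm_smul, Complex.norm_real, ← mul_assoc]
    gcongr
    simp only [hb, Real.norm_eq_abs]
    rw [abs_of_nonneg (by positivity), abs_of_nonneg (by positivity),
      show -(s - 1) / 2 = 1 / 2 + -s / 2 by ring, Real.rpow_add (by positivity),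
      ← Real.sqrt_eq_rpow]
    gcongr
    exact Real.le_sqrt_of_sq_le (by linarith)
  have hbW : Integrable fun ξ ↦ ‖b (s - 1) ξ‖ * ‖W ξ‖ := hb1.norm.integrable_mul hW.norm
  have hv' : Integrable fun ξ ↦ ‖ξ‖ * ‖(b s ξ : ℂ) • W ξ‖ := by
    refine hbW.mono' (continuous_norm.aestronglyMeasurable.mul hv.1.norm) (.of_forall fun ξ ↦ ?_)
    rw [norm_mul, norm_norm, norm_norm]
    exact hle ξ
  refine ⟨𝓕⁻ fun ξ ↦ (b s ξ : ℂ) • W ξ, continuous_fourierInv_of_integrable hv,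
    ae_eq_fourierInv_of_fourier_eq hv fun φ ↦ ?_, fun x y ↦ ?_⟩
  -- The Bessel multiplier is inverted: its product with `b s` is 1.
  · have hF : 𝓕 (U : 𝓢'(E, F)) = smulLeftCLM F (fun x ↦ (b s x : ℂ)) (𝓕 V : Lp F 2 volume) := by
      rw [← Lp.fourier_toTemperedDistribution_eq, ← hUV,
        fourier_besselPotential_eq_smulLeftCLM_fourier_apply,
        smulLeftCLM_smulLeftCLM_apply (by fun_prop) (by simp only [hb]; fun_prop)]
      convert! (smulLeftCLM_const 1 (𝓕 (U : 𝓢'(E, F)))).symm using 1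
      · simp
      · congr
        ext x
        rw [Pi.mul_apply]
        norm_cast
        rw [← Real.rpow_add (by positivity)]
        ring_nf
        simp
    rw [hF, smulLeftCLM_apply_apply, Lp.toTemperedDistribution_apply]
    refine integral_congr_ae (.of_forall fun ξ ↦ ?_)
    have hg : (fun x ↦ (b s x : ℂ)).HasTemperateGrowth := by simp only [hb]; fun_prop
    simp only [SchwartzMap.smulLeftCLM_apply_apply hg, smul_eq_mul]
    rw [mul_comm, mul_smul]
  · refine (norm_fourierInv_sub_le hv hv' x y).trans ?_
    gcongr ?_ * _
    rw [mul_assoc (2 * Real.pi) _ ‖V‖]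
    gcongr
    calc _ ≤ ∫ ξ, ‖b (s - 1) ξ‖ * ‖W ξ‖ := integral_mono hv' hbW hle
      _ ≤ (∫ ξ, ‖b (s - 1) ξ‖ ^ (2 : ℝ)) ^ (1 / (2 : ℝ)) * (∫ ξ, ‖W ξ‖ ^ (2 : ℝ)) ^ (1 / (2 : ℝ)) :=
        integral_mul_le_Lp_mul_Lq_of_nonneg .two_two (.of_forall fun _ ↦ norm_nonneg _)
          (.of_forall fun _ ↦ norm_nonneg _) (by simpa only [ENNReal.ofReal_ofNat] using hb1.norm)
          (by simpa only [ENNReal.ofReal_ofNat] using hW.norm)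
      _ = _ := by
        congr 1
        rw [← Lp.norm_fourier_eq V, Lp.norm_def, hW.eLpNorm_eq_integral_rpow_norm two_ne_zero
          ENNReal.ofNat_ne_top, ENNReal.toReal_ofReal (by positivity)]
        simp [W]

end SobolevEmbedding

theorem IsSobolevExtension.exists_lipschitz_rep {d m : ℕ} {s : ℝ} (hs : 1 + (d : ℝ) / 2 < s) :
    ∃ L : ℝ, 0 ≤ L ∧ ∀ (Ω : Set (EuclideanSpace ℝ (Fin d)))
      (f : EuclideanSpace ℝ (Fin d) → EuclideanSpace ℝ (Fin m)) U V,
      IsSobolevExtension Ω s f U V →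
      ∃ g : EuclideanSpace ℝ (Fin d) → EuclideanSpace ℝ (Fin m), Continuous g ∧
        f =ᵐ[volume.restrict Ω] g ∧ ∀ x y, ‖g x - g y‖ ≤ L * ‖V‖ * ‖x - y‖ := by
  obtain ⟨L, hL, h⟩ := exists_lipschitz_rep_of_besselPotential_eq
    (E := EuclideanSpace ℝ (Fin d)) (F := EuclideanSpace ℂ (Fin m)) (s := s) (by simpa using hs)
  refine ⟨L, hL, fun Ω f U V hUV ↦ ?_⟩
  obtain ⟨u, huc, hUu, hu⟩ := h U V hUV.bessel
  refine ⟨fun x ↦ WithLp.toLp 2 fun i ↦ (u x i).re, by fun_prop, ?_, fun x y ↦ ?_⟩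
  · filter_upwards [hUV.eq_on, ae_restrict_of_ae hUu] with x hx hux
    ext i
    simp [← hux, hx i]
  · refine le_trans ?_ (hu x y)
    rw [EuclideanSpace.norm_eq, EuclideanSpace.norm_eq]
    gcongr with i
    simpa using Complex.abs_re_le_norm (u x i - u y i)

/-! ### Sums and cardinalities of separated families -/

section Packing

open Metric Module

theorem pairwise_disjoint_ball_of_two_mul_le_dist {ι E : Type*} [PseudoMetricSpace E] {ν : ι → E} {η : ℝ}
    (hν : Pairwise fun i j ↦ 2 * η ≤ dist (ν i) (ν j)) :
    Pairwise fun i j ↦ Disjoint (ball (ν i) η) (ball (ν j) η) :=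
  fun _ _ hij ↦ ball_disjoint_ball (by linarith [hν hij])

/-- Sum against integral: on the ball of radius `η ≤ 1` about `ν i` one has `1 + ‖z‖ ≤ 2 (1 + ‖ν
i‖)`, and these balls are disjoint. -/
theorem sum_one_add_norm_rpow_mul_measure_ball_le {ι E : Type*} [NormedAddCommGroup E]
    [NormedSpace ℝ E] [FiniteDimensional ℝ E] [MeasurableSpace E] [BorelSpace E] (μ : Measure E)
    [μ.IsAddHaarMeasure] [Fintype ι] {ν : ι → E} {η r : ℝ} (hη : η ≤ 1)
    (hν : Pairwise fun i j ↦ 2 * η ≤ dist (ν i) (ν j)) (hr : (finrank ℝ E : ℝ) < r) :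
    (∑ i, (1 + ‖ν i‖) ^ (-r)) * μ.real (ball 0 η) ≤ 2 ^ r * ∫ z, (1 + ‖z‖) ^ (-r) ∂μ := by
  have hr0 : 0 < r := (Nat.cast_nonneg _).trans_lt hr
  have hint : Integrable (fun z ↦ (1 + ‖z‖) ^ (-r)) μ := integrable_one_add_norm hr
  have hball (i : ι) : (1 + ‖ν i‖) ^ (-r) * μ.real (ball 0 η) ≤
      ∫ z in ball (ν i) η, 2 ^ r * (1 + ‖z‖) ^ (-r) ∂μ := by
    rw [measureReal_def, ← Measure.addHaar_ball_center μ (ν i),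
      ← measureReal_def, mul_comm, ← smul_eq_mul, ← setIntegral_const]
    refine setIntegral_mono_on (integrableOn_const measure_ball_lt_top.ne) (hint.const_mul _).integrableOn measurableSet_ball
      fun z hz ↦ ?_
    have hz' : ‖z‖ ≤ ‖ν i‖ + 1 := by
      have := norm_le_norm_add_norm_sub (ν i) z
      rw [mem_ball, dist_comm, dist_eq_norm] at hz
      linarith
    rw [← neg_neg r, Real.rpow_neg zero_le_two, neg_neg, ← Real.inv_rpow zero_le_two,
      ← Real.mul_rpow (by norm_num) (by positivity)]
    exact Real.rpow_le_rpow_of_nonpos (by positivity)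
      (by linarith [norm_nonneg (ν i)]) (by linarith)
  calc _ = ∑ i, (1 + ‖ν i‖) ^ (-r) * μ.real (ball 0 η) := Finset.sum_mul _ _ _
    _ ≤ ∑ i, ∫ z in ball (ν i) η, 2 ^ r * (1 + ‖z‖) ^ (-r) ∂μ :=
        Finset.sum_le_sum fun i _ ↦ hball i
    _ = ∫ z in ⋃ i, ball (ν i) η, 2 ^ r * (1 + ‖z‖) ^ (-r) ∂μ :=
        (integral_iUnion_fintype (fun _ ↦ measurableSet_ball)
          (pairwise_disjoint_ball_of_two_mul_le_dist hν)
          fun _ ↦ (hint.const_mul _).integrableOn).symm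
    _ ≤ ∫ z, 2 ^ r * (1 + ‖z‖) ^ (-r) ∂μ :=
        setIntegral_le_integral (hint.const_mul _) (.of_forall fun z ↦ by positivity)
    _ = _ := integral_const_mul _ _

theorem card_mul_pow_finrank_le {ι E : Type*} [NormedAddCommGroup E]
    [NormedSpace ℝ E] [FiniteDimensional ℝ E] [MeasurableSpace E] [BorelSpace E] (μ : Measure E)
    [μ.IsAddHaarMeasure] [Fintype ι] {ν : ι → E} {η B : ℝ} (hη : 0 < η) (hB : 0 < B)
    (hν : Pairwise fun i j ↦ 2 * η ≤ dist (ν i) (ν j)) (hνB : ∀ i, ‖ν i‖ + η ≤ B) :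
    Fintype.card ι * η ^ finrank ℝ E ≤ B ^ finrank ℝ E := by
  have hpos : 0 < μ.real (ball (0 : E) 1) :=
    ENNReal.toReal_pos (measure_ball_pos μ _ one_pos).ne' measure_ball_lt_top.ne
  have hball (x : E) {r : ℝ} (hr : 0 < r) :
      μ.real (ball x r) = r ^ finrank ℝ E * μ.real (ball 0 1) := by
    rw [measureReal_def, Measure.addHaar_ball_of_pos μ x hr, ENNReal.toReal_mul,
      ENNReal.toReal_ofReal (by positivity), measureReal_def]
  refine le_of_mul_le_mul_right ?_ hpos
  calc _ = ∑ i, μ.real (ball (ν i) η) := by simp [hball _ hη, mul_assoc]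
    _ = μ.real (⋃ i, ball (ν i) η) := by
        rw [measureReal_iUnion_fintype (pairwise_disjoint_ball_of_two_mul_le_dist hν)
          (fun _ ↦ measurableSet_ball) fun _ ↦ measure_ball_lt_top.ne]
    _ ≤ μ.real (ball 0 B) := by
        refine measureReal_mono (Set.iUnion_subset fun i ↦ ball_subset_ball' ?_)
          measure_ball_lt_top.ne
        rw [dist_zero_right, add_comm]
        exact hνB i
    _ = _ := hball _ hB

end Packing

/-! ### Gaussian decay and quadratic form bounds -/

theorem exists_mul_exp_neg_sq_le {C : ℝ} (hC : 0 < C) (n : ℕ) :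
    ∃ M : ℝ, 0 < M ∧ ∀ t : ℝ, 0 ≤ t →
      t * Real.exp (-(1 / 2) * (t ^ 2 / C)) ≤ M * (1 + t) ^ (-(n : ℝ)) := by
  set N := n + 1
  -- From `u ^ N / N! ≤ exp u` at `u = (1 + t²) / (2C)`: the factor `exp (1 / (2C))` pays for the
  -- added 1, and `N = n + 1` absorbs the extra `t`.
  refine ⟨2 ^ N * (2 * C) ^ N * N.factorial * Real.exp (1 / (2 * C)), by positivity, fun t ht ↦ ?_⟩
  have h₁ : ((1 + t ^ 2) / (2 * C)) ^ N / N.factorial ≤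
      Real.exp (1 / (2 * C)) * Real.exp (-(-(1 / 2) * (t ^ 2 / C))) := by
    rw [← Real.exp_add]
    refine (Real.pow_div_factorial_le_exp _ (by positivity) N).trans_eq ?_
    congr 1
    field_simp
  have h₂ : t * (1 + t) ^ n ≤ 2 ^ N * (1 + t ^ 2) ^ N := by
    calc t * (1 + t) ^ n ≤ (1 + t) * (1 + t) ^ n := by gcongr; linarith
      _ = (1 + t) ^ N := by rw [pow_succ']
      _ ≤ (2 * (1 + t ^ 2)) ^ N := by gcongr; nlinarith [sq_nonneg (t - 1)]
      _ = _ := mul_pow _ _ _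
  rw [Real.exp_neg, ← div_eq_mul_inv, le_div_iff₀ (Real.exp_pos _), div_pow, div_div,
    div_mul_eq_mul_div, div_le_iff₀ (by positivity)] at h₁
  rw [Real.rpow_neg (by positivity), Real.rpow_natCast, ← div_eq_mul_inv,
    le_div_iff₀ (by positivity)]
  calc _ = t * (1 + t) ^ n * Real.exp (-(1 / 2) * (t ^ 2 / C)) := by ring
    _ ≤ 2 ^ N * (1 + t ^ 2) ^ N * Real.exp (-(1 / 2) * (t ^ 2 / C)) := by gcongr
    _ = 2 ^ N * ((1 + t ^ 2) ^ N * Real.exp (-(1 / 2) * (t ^ 2 / C))) := by ring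
    _ ≤ 2 ^ N * (Real.exp (1 / (2 * C)) * ((2 * C) ^ N * N.factorial)) := by gcongr
    _ = _ := by ring

theorem EuclideanSpace.ofLp_dotProduct_self {ι : Type*} [Fintype ι] (x : EuclideanSpace ℝ ι) :
    x.ofLp ⬝ᵥ x.ofLp = ‖x‖ ^ 2 := by
  rw [real_norm_sq_eq]
  simp only [dotProduct, sq]

namespace IsComparableToSq

open Matrix

variable {d : ℕ} {c C h : ℝ} {S : Matrix (Fin d) (Fin d) ℝ}

theorem sq_mul_dotProduct_le (hS : IsComparableToSq c C h S) (v : Fin d → ℝ) :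
    c * h ^ 2 * (v ⬝ᵥ v) ≤ v ⬝ᵥ S *ᵥ v := by
  have := hS.lower.dotProduct_mulVec_nonneg v
  simpa [sub_mulVec, smul_mulVec, dotProduct_sub] using this

theorem dotProduct_le_sq_mul (hS : IsComparableToSq c C h S) (v : Fin d → ℝ) :
    v ⬝ᵥ S *ᵥ v ≤ C * h ^ 2 * (v ⬝ᵥ v) := by
  have := hS.upper.dotProduct_mulVec_nonneg v
  simpa [sub_mulVec, smul_mulVec, dotProduct_sub] using this

theorem isSymm (hS : IsComparableToSq c C h S) : Sᵀ = S := by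
  have h₁ : (S - (c * h ^ 2) • (1 : Matrix (Fin d) (Fin d) ℝ))ᵀ = _ := hS.lower.isHermitian
  simpa using h₁

theorem isUnit_det (hS : IsComparableToSq c C h S) (hc : 0 < c) (hh : 0 < h) : IsUnit S.det := by
  have hp : S.PosDef := .of_dotProduct_mulVec_pos (by simpa using! hS.isSymm) fun v hv ↦ by
    have hv' : 0 < v ⬝ᵥ v := by simpa using dotProduct_star_self_pos_iff.2 hv
    simpa using (by positivity : 0 < c * h ^ 2 * (v ⬝ᵥ v)).trans_le (hS.sq_mul_dotProduct_le v)
  exact hp.det_pos.ne'.isUnit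

/-- With `y = S⁻¹v`, expand `|v - c h² y|² ≥ 0` and use `c h² |y|² ≤ y·v`. -/
theorem sq_mul_inv_le (hS : IsComparableToSq c C h S) (hc : 0 < c) (hh : 0 < h) (v : Fin d → ℝ) :
    c * h ^ 2 * (v ⬝ᵥ S⁻¹ *ᵥ v) ≤ v ⬝ᵥ v := by
  set y := S⁻¹ *ᵥ v
  have hy : S *ᵥ y = v := by rw [mulVec_mulVec, mul_nonsing_inv _ (hS.isUnit_det hc hh), one_mulVec]
  have h₁ := hS.sq_mul_dotProduct_le y
  have h₂ : 0 ≤ (v - (c * h ^ 2) • y) ⬝ᵥ (v - (c * h ^ 2) • y) := by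
    simpa using dotProduct_star_self_nonneg (v - (c * h ^ 2) • y)
  rw [hy, dotProduct_comm y v] at h₁
  simp only [sub_dotProduct, dotProduct_sub, smul_dotProduct, dotProduct_smul, smul_eq_mul,
    dotProduct_comm y v] at h₂
  nlinarith [mul_le_mul_of_nonneg_left h₁ (by positivity : 0 ≤ c * h ^ 2)]

/-- The same expansion, now in the form of `S`, at `v - C h² S⁻¹v`. -/
theorem le_sq_mul_inv (hS : IsComparableToSq c C h S) (hc : 0 < c) (hC : 0 < C) (hh : 0 < h)
    (v : Fin d → ℝ) : v ⬝ᵥ v ≤ C * h ^ 2 * (v ⬝ᵥ S⁻¹ *ᵥ v) := by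
  set y := S⁻¹ *ᵥ v
  set t := C * h ^ 2
  have ht : 0 < t := by positivity
  have hy : S *ᵥ y = v := by rw [mulVec_mulVec, mul_nonsing_inv _ (hS.isUnit_det hc hh), one_mulVec]
  have h₁ := hS.dotProduct_le_sq_mul v
  have h₂ : 0 ≤ (v - t • y) ⬝ᵥ S *ᵥ (v - t • y) :=
    (by have := dotProduct_star_self_nonneg (v - t • y); positivity :
      0 ≤ c * h ^ 2 * ((v - t • y) ⬝ᵥ star (v - t • y))).trans (hS.sq_mul_dotProduct_le _)
  have h₃ : y ⬝ᵥ S *ᵥ v = v ⬝ᵥ v := by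
    rw [dotProduct_mulVec, ← mulVec_transpose, hS.isSymm, hy]
  simp only [mulVec_sub, mulVec_smul, hy, sub_dotProduct, dotProduct_sub, smul_dotProduct,
    dotProduct_smul, smul_eq_mul, h₃, dotProduct_comm y v] at h₂
  refine le_of_mul_le_mul_left ?_ ht
  linarith

theorem pos_upper (hS : IsComparableToSq c C h S) (hd : 0 < d) (hc : 0 < c) (hh : 0 < h) :
    0 < C := by
  have h₁ := (hS.sq_mul_dotProduct_le (Pi.single ⟨0, hd⟩ 1)).trans (hS.dotProduct_le_sq_mul _)
  simp only [single_one_dotProduct, Pi.single_eq_same, mul_one] at h₁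
  exact pos_of_mul_pos_left ((by positivity : 0 < c * h ^ 2).trans_le h₁) (by positivity)

theorem exp_le_gaussianPrimitive (hS : IsComparableToSq c C h S) (hc : 0 < c) (hh : 0 < h)
    {x μ : EuclideanSpace ℝ (Fin d)} (hx : ‖x - μ‖ ≤ h) :
    Real.exp (-(1 / 2) * (1 / c)) ≤ gaussianPrimitive μ S x := by
  have h₁ := hS.sq_mul_inv_le hc hh (x - μ).ofLp
  have h₂ : (x - μ).ofLp ⬝ᵥ (x - μ).ofLp ≤ h ^ 2 := by
    rw [EuclideanSpace.ofLp_dotProduct_self]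
    gcongr
  have h₃ : (x - μ).ofLp ⬝ᵥ S⁻¹ *ᵥ (x - μ).ofLp ≤ 1 / c := by
    rw [le_div_iff₀ hc]
    refine le_of_mul_le_mul_right ?_ (by positivity : 0 < h ^ 2)
    linarith
  refine Real.exp_le_exp.2 ?_
  linarith

theorem gaussianPrimitive_le_exp (hS : IsComparableToSq c C h S) (hc : 0 < c) (hC : 0 < C)
    (hh : 0 < h) (x μ : EuclideanSpace ℝ (Fin d)) :
    gaussianPrimitive μ S x ≤ Real.exp (-(1 / 2) * ((‖x - μ‖ / h) ^ 2 / C)) := by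
  have h₁ := hS.le_sq_mul_inv hc hC hh (x - μ).ofLp
  have h₃ : (‖x - μ‖ / h) ^ 2 / C ≤ (x - μ).ofLp ⬝ᵥ S⁻¹ *ᵥ (x - μ).ofLp := by
    rw [div_pow, div_div, div_le_iff₀ (by positivity), ← EuclideanSpace.ofLp_dotProduct_self]
    linarith
  refine Real.exp_le_exp.2 ?_
  linarith

end IsComparableToSq

/-! ### The Gaussian partition of unity -/

section Shepard

variable {d m K : ℕ} {w : Fin K → ℝ} {μ : Fin K → EuclideanSpace ℝ (Fin d)}
  {S : Fin K → Matrix (Fin d) (Fin d) ℝ}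

theorem gaussianPrimitive_pos (ν x : EuclideanSpace ℝ (Fin d)) (T : Matrix (Fin d) (Fin d) ℝ) :
    0 < gaussianPrimitive ν T x := Real.exp_pos _

theorem shepardWeight_nonneg (hw : ∀ k, 0 < w k) (k : Fin K) (x : EuclideanSpace ℝ (Fin d)) :
    0 ≤ shepardWeight w μ S k x :=
  div_nonneg (mul_nonneg (hw k).le (gaussianPrimitive_pos _ _ _).le)
    (Finset.sum_nonneg fun j _ ↦ mul_nonneg (hw j).le (gaussianPrimitive_pos _ _ _).le)

theorem sum_shepardWeight (hK : 1 ≤ K) (hw : ∀ k, 0 < w k) (x : EuclideanSpace ℝ (Fin d)) :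
    ∑ k, shepardWeight w μ S k x = 1 := by
  have : Nonempty (Fin K) := ⟨⟨0, hK⟩⟩
  simp only [shepardWeight]
  rw [← Finset.sum_div]
  exact div_self (Finset.sum_pos (fun j _ ↦ mul_pos (hw j) (gaussianPrimitive_pos _ _ _))
    Finset.univ_nonempty).ne'

theorem norm_sub_scaffold_le (hK : 1 ≤ K) (hw : ∀ k, 0 < w k) (a : Fin K → EuclideanSpace ℝ (Fin m))
    (b : EuclideanSpace ℝ (Fin m)) (x : EuclideanSpace ℝ (Fin d)) {L : ℝ}
    (hL : ∀ k, ‖b - a k‖ ≤ L * ‖x - μ k‖) :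
    ‖b - scaffold w μ S a x‖ ≤ L * ∑ k, shepardWeight w μ S k x * ‖x - μ k‖ := by
  have h : b - scaffold w μ S a x = ∑ k, shepardWeight w μ S k x • (b - a k) := by
    simp_rw [smul_sub, Finset.sum_sub_distrib, ← Finset.sum_smul, sum_shepardWeight hK hw, one_smul,
      scaffold]
  rw [h, Finset.mul_sum]
  refine norm_sum_le_of_le _ fun k _ ↦ ?_
  rw [norm_smul, Real.norm_of_nonneg (shepardWeight_nonneg hw k x), mul_left_comm]
  exact mul_le_mul_of_nonneg_left (hL k) (shepardWeight_nonneg hw k x)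

theorem exists_sum_shepardWeight_mul_norm_sub_le (hd : 0 < d) {R wmin wmax c C : ℝ} (hR : 1 ≤ R)
    (hwmin : 0 < wmin) (hc : 0 < c) :
    ∃ A : ℝ, 0 ≤ A ∧ ∀ {K : ℕ} {w : Fin K → ℝ} {μ : Fin K → EuclideanSpace ℝ (Fin d)}
      {S : Fin K → Matrix (Fin d) (Fin d) ℝ} {h : ℝ}, 0 < h →
      (Pairwise fun i j ↦ 2 * (h / R) ≤ dist (μ i) (μ j)) → (∀ k, wmin ≤ w k ∧ w k ≤ wmax) →
      (∀ k, IsComparableToSq c C h (S k)) →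
      ∀ x, (∃ k, ‖x - μ k‖ ≤ h) → ∑ k, shepardWeight w μ S k x * ‖x - μ k‖ ≤ A * h := by
  -- For `C ≤ 0` or `wmax < wmin` no data are admissible once there is a center, so `A = 0` serves.
  rcases le_or_gt C 0 with hC | hC
  · exact ⟨0, le_rfl, fun hh _ _ hS x ⟨k, _⟩ ↦ absurd ((hS k).pos_upper hd hc hh) hC.not_gt⟩
  rcases lt_or_ge wmax wmin with hww | hww
  · exact ⟨0, le_rfl, fun _ _ hw _ x ⟨k, _⟩ ↦ absurd ((hw k).1.trans (hw k).2) hww.not_ge⟩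
  have hwmax : 0 < wmax := hwmin.trans_le hww
  -- `d + 1` is an integer decay exponent above the dimension, so the comparison integral converges.
  obtain ⟨M, hM, hMt⟩ := exists_mul_exp_neg_sq_le hC (d + 1)
  set β : ℝ := volume.real (Metric.ball (0 : EuclideanSpace ℝ (Fin d)) (1 / R))
  have hβ : 0 < β := ENNReal.toReal_pos (Metric.measure_ball_pos _ _ (by positivity)).ne'
    measure_ball_lt_top.ne
  set I : ℝ := 2 ^ ((d + 1 : ℕ) : ℝ) *
    ∫ z : EuclideanSpace ℝ (Fin d), (1 + ‖z‖) ^ (-((d + 1 : ℕ) : ℝ))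
  have hI : 0 ≤ I := mul_nonneg (by positivity) (integral_nonneg fun z ↦ by positivity)
  set D : ℝ := wmin * Real.exp (-(1 / 2) * (1 / c))
  have hD : 0 < D := by positivity
  refine ⟨wmax / D * M * (I / β), by positivity, fun {K w μ S h} hh hμ hw hS x ⟨k₀, hk₀⟩ ↦ ?_⟩
  have hw0 (k) : 0 < w k := hwmin.trans_le (hw k).1
  have hden : D ≤ ∑ j, w j * gaussianPrimitive (μ j) (S j) x := by
    refine le_trans ?_ (Finset.single_le_sum (fun j _ ↦ mul_nonneg (hw0 j).le
      (gaussianPrimitive_pos _ _ _).le) (Finset.mem_univ k₀))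
    exact mul_le_mul (hw k₀).1 ((hS k₀).exp_le_gaussianPrimitive hc hh hk₀) (by positivity)
      (hw0 k₀).le
  have hterm (k) : shepardWeight w μ S k x * ‖x - μ k‖ ≤
      wmax / D * M * h * (1 + ‖h⁻¹ • (x - μ k)‖) ^ (-((d + 1 : ℕ) : ℝ)) := by
    have hn : ‖h⁻¹ • (x - μ k)‖ = ‖x - μ k‖ / h := by
      rw [norm_smul, norm_inv, Real.norm_of_nonneg hh.le, inv_mul_eq_div]
    have h₁ : shepardWeight w μ S k x ≤
        wmax * Real.exp (-(1 / 2) * ((‖x - μ k‖ / h) ^ 2 / C)) / D := by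
      unfold shepardWeight
      gcongr
      · exact (gaussianPrimitive_pos _ _ _).le
      · exact (hw k).2
      · exact (hS k).gaussianPrimitive_le_exp hc hC hh x (μ k)
    rw [hn]
    calc _ ≤ wmax * Real.exp (-(1 / 2) * ((‖x - μ k‖ / h) ^ 2 / C)) / D * ‖x - μ k‖ := by gcongr
      _ = wmax / D * h * (‖x - μ k‖ / h * Real.exp (-(1 / 2) * ((‖x - μ k‖ / h) ^ 2 / C))) := by
        field_simp
      _ ≤ wmax / D * h * (M * (1 + ‖x - μ k‖ / h) ^ (-((d + 1 : ℕ) : ℝ))) := by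
        exact mul_le_mul_of_nonneg_left (hMt _ (by positivity)) (by positivity)
      _ = _ := by ring
  -- Rescaled by `h`, the centers are `2 / R`-separated, so the bound no longer depends on `h` or
  -- `K`.
  have hsum : ∑ k, (1 + ‖h⁻¹ • (x - μ k)‖) ^ (-((d + 1 : ℕ) : ℝ)) ≤ I / β := by
    rw [le_div_iff₀ hβ]
    refine sum_one_add_norm_rpow_mul_measure_ball_le volume ((div_le_one (by positivity)).2 hR)
      (fun i j hij ↦ ?_) (by simp)
    have : 2 * (h / R) ≤ dist (μ i) (μ j) := hμ hij
    change 2 * (1 / R) ≤ dist (h⁻¹ • (x - μ i)) (h⁻¹ • (x - μ j))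
    rw [dist_smul₀, dist_sub_left, norm_inv, Real.norm_of_nonneg hh.le, inv_mul_eq_div,
      le_div_iff₀ hh]
    exact le_trans (le_of_eq (by ring)) this
  calc _ ≤ ∑ k, wmax / D * M * h * (1 + ‖h⁻¹ • (x - μ k)‖) ^ (-((d + 1 : ℕ) : ℝ)) :=
        Finset.sum_le_sum fun k _ ↦ hterm k
    _ = wmax / D * M * h * ∑ k, (1 + ‖h⁻¹ • (x - μ k)‖) ^ (-((d + 1 : ℕ) : ℝ)) :=
        (Finset.mul_sum _ _ _).symm
    _ ≤ wmax / D * M * h * (I / β) := by gcongr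
    _ = _ := by ring

end Shepard

/-! ### Fill distance and number of centers -/

namespace IsQuasiUniform

variable {d K : ℕ} {Ω : Set (EuclideanSpace ℝ (Fin d))} {ρ : ℝ≥0}
  {μ : Fin K → EuclideanSpace ℝ (Fin d)} {B : ℝ}

theorem fillDistance_le (hμ : IsQuasiUniform Ω ρ μ) (hK : 1 ≤ K) (hB : ∀ x ∈ Ω, ‖x‖ ≤ B) :
    fillDistance Ω μ ≤ ENNReal.ofReal (2 * B) := by
  refine iSup₂_le fun x hx ↦ (iInf_le _ ⟨0, hK⟩).trans ?_
  rw [edist_dist]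
  refine ENNReal.ofReal_le_ofReal ((dist_le_norm_add_norm _ _).trans ?_)
  linarith [hB x hx, hB _ (hμ.mem ⟨0, hK⟩)]

theorem exists_edist_le_fillDistance (hK : 1 ≤ K) {x : EuclideanSpace ℝ (Fin d)} (hx : x ∈ Ω) :
    ∃ k, edist x (μ k) ≤ fillDistance Ω μ := by
  have : Nonempty (Fin K) := ⟨⟨0, hK⟩⟩
  obtain ⟨k, hk⟩ := exists_eq_ciInf_of_finite (f := fun k ↦ edist x (μ k))
  exact ⟨k, hk.trans_le (le_iSup₂_of_le x hx le_rfl)⟩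

/-- Otherwise the nonempty open set `Ω` would consist of centers, a finite set, which is null as `d
> 0`. -/
theorem fillDistance_pos (hμ : IsQuasiUniform Ω ρ μ) (hd : 0 < d) (hK : 1 ≤ K) (hΩ : IsOpen Ω) :
    0 < fillDistance Ω μ := by
  have : Nonempty (Fin d) := ⟨⟨0, hd⟩⟩
  by_contra! h
  have hsub : Ω ⊆ Set.range μ := fun x hx ↦ by
    obtain ⟨k, hk⟩ := exists_edist_le_fillDistance (μ := μ) hK hx
    exact ⟨k, (edist_eq_zero.1 (le_antisymm (hk.trans h) bot_le)).symm⟩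
  refine (hΩ.measure_pos volume ⟨_, hμ.mem ⟨0, hK⟩⟩).ne' ?_
  exact measure_mono_null hsub ((Set.finite_range μ).measure_zero _)

/-- Replacing `ρ` by `max ρ 1` avoids division by zero and keeps the ball radius at most `h`. -/
theorem fillDistance_div_le_dist (hμ : IsQuasiUniform Ω ρ μ) :
    Pairwise fun i j ↦ 2 * ((fillDistance Ω μ).toReal / max (ρ : ℝ) 1) ≤ dist (μ i) (μ j) := by
  intro i j hij
  have h₁ : fillDistance Ω μ ≤ ρ * (edist (μ i) (μ j) / 2) := by
    refine hμ.fill_le.trans ?_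
    unfold separationRadius
    gcongr
    exact iInf_le_of_le i (iInf₂_le j hij)
  have h₂ := ENNReal.toReal_mono (by finiteness) h₁
  rw [ENNReal.toReal_mul, ENNReal.toReal_div, ← dist_edist, ENNReal.coe_toReal,
    ENNReal.toReal_ofNat] at h₂
  have h₃ : (fillDistance Ω μ).toReal / max (ρ : ℝ) 1 ≤ dist (μ i) (μ j) / 2 := by
    rw [div_le_iff₀' (by positivity)]
    refine h₂.trans ?_
    gcongr
    exact le_max_left _ _
  change 2 * _ ≤ _
  linarith

theorem toReal_fillDistance_le (hμ : IsQuasiUniform Ω ρ μ) (hd : 0 < d) (hK : 1 ≤ K)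
    (hΩ : IsOpen Ω) (hB0 : 0 < B) (hB : ∀ x ∈ Ω, ‖x‖ ≤ B) :
    (fillDistance Ω μ).toReal ≤ max (ρ : ℝ) 1 * (3 * B) * (K : ℝ) ^ (-(1 / (d : ℝ))) := by
  set h := (fillDistance Ω μ).toReal
  have hfin : fillDistance Ω μ ≠ ∞ := ((hμ.fillDistance_le hK hB).trans_lt ENNReal.ofReal_lt_top).ne
  have hh : 0 < h := ENNReal.toReal_pos (hμ.fillDistance_pos hd hK hΩ).ne' hfin
  have hh2 : h ≤ 2 * B := ENNReal.toReal_le_of_le_ofReal (by positivity) (hμ.fillDistance_le hK hB)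
  have hR : (1 : ℝ) ≤ max (ρ : ℝ) 1 := le_max_right _ _
  set R : ℝ := max (ρ : ℝ) 1
  -- Centers have norm at most `B` and `h / R ≤ h ≤ 2B`, whence the enclosing radius `3B`.
  have hcard := card_mul_pow_finrank_le volume (ν := μ) (η := h / R) (B := 3 * B) (by positivity)
    (by positivity) hμ.fillDistance_div_le_dist fun i ↦ by
      linarith [hB _ (hμ.mem i), div_le_self hh.le hR]
  rw [Fintype.card_fin, finrank_euclideanSpace_fin] at hcard
  have hK0 : (0 : ℝ) < K := by positivity
  have hroot : ((K : ℝ) ^ (1 / (d : ℝ))) ^ d = K := by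
    rw [← Real.rpow_mul_natCast hK0.le, one_div_mul_cancel (by positivity), Real.rpow_one]
  have hle : (K : ℝ) ^ (1 / (d : ℝ)) * (h / R) ≤ 3 * B := by
    refine le_of_pow_le_pow_left₀ hd.ne' (by positivity) ?_
    rwa [mul_pow, hroot]
  rw [Real.rpow_neg hK0.le, ← div_eq_mul_inv, le_div_iff₀ (by positivity)]
  rw [← mul_div_assoc, div_le_iff₀ (by positivity)] at hle
  linarith

end IsQuasiUniform

/-! ### The error estimate -/

theorem proposition2 {d m : ℕ} (hd : 0 < d)
    {Ω : Set (EuclideanSpace ℝ (Fin d))} (hΩ : IsOpen Ω) (hΩb : Bornology.IsBounded Ω)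
    {s : ℝ} (hs : 1 + (d : ℝ) / 2 < s)
    (ρ : ℝ≥0) {wmin wmax cS CS : ℝ} (hwmin : 0 < wmin) (hcS : 0 < cS) :
    ∃ C : ℝ≥0, ∀ f : EuclideanSpace ℝ (Fin d) → EuclideanSpace ℝ (Fin m),
      MemSobolevOn Ω s f →
      (∃ g, IsContinuousRep Ω f g) ∧
      ∀ g, IsContinuousRep Ω f g →
      ∀ K : ℕ, 1 ≤ K →
      ∀ μ : Fin K → EuclideanSpace ℝ (Fin d), IsQuasiUniform Ω ρ μ →
      ∀ w : Fin K → ℝ, (∀ k, wmin ≤ w k ∧ w k ≤ wmax) →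
      ∀ S : Fin K → Matrix (Fin d) (Fin d) ℝ,
        (∀ k, IsComparableToSq cS CS (fillDistance Ω μ).toReal (S k)) →
        eLpNorm (fun x => f x - scaffold w μ S (fun k => g (μ k)) x) 2 (volume.restrict Ω) ≤
          C * ENNReal.ofReal ((K : ℝ) ^ (-(1 / (d : ℝ)))) * sobolevENormOn Ω s f := by
  obtain ⟨L, hL, hrep⟩ := IsSobolevExtension.exists_lipschitz_rep (m := m) hs
  obtain ⟨A, hA, hsum⟩ := exists_sum_shepardWeight_mul_norm_sub_le hd (le_max_right (ρ : ℝ) 1)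
    (wmax := wmax) (C := CS) hwmin hcS
  obtain ⟨B, hB0, hB⟩ := hΩb.exists_pos_norm_le
  set R : ℝ := max (ρ : ℝ) 1
  have hvol : volume Ω ^ (2 : ℝ)⁻¹ ≠ ∞ := ENNReal.rpow_ne_top_of_nonneg (by positivity)
    hΩb.measure_lt_top.ne
  have hM : 0 ≤ L * A * (R * (3 * B)) := by positivity
  refine ⟨(volume Ω ^ (2 : ℝ)⁻¹).toNNReal * (L * A * (R * (3 * B))).toNNReal,
    fun f hf ↦ ⟨?_, fun g hg K hK μ hμ w hw S hS ↦ ?_⟩⟩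
  · obtain ⟨U, V, hUV⟩ := hf
    obtain ⟨g, hgc, hfg, -⟩ := hrep Ω f U V hUV
    exact ⟨g, hgc.continuousOn, hfg⟩
  set h := (fillDistance Ω μ).toReal
  have hfin : fillDistance Ω μ ≠ ∞ := ((hμ.fillDistance_le hK hB).trans_lt ENNReal.ofReal_lt_top).ne
  have hh : 0 < h := ENNReal.toReal_pos (hμ.fillDistance_pos hd hK hΩ).ne' hfin
  have hhK := hμ.toReal_fillDistance_le hd hK hΩ hB0 hB
  have hK0 : (0 : ℝ) < (K : ℝ) ^ (-(1 / (d : ℝ))) := by positivity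
  set κ := (K : ℝ) ^ (-(1 / (d : ℝ)))
  have hw0 (k) : 0 < w k := hwmin.trans_le (hw k).1
  have key (U V) (hUV : IsSobolevExtension Ω s f U V) :
      eLpNorm (fun x ↦ f x - scaffold w μ S (fun k ↦ g (μ k)) x) 2 (volume.restrict Ω) ≤
        ((volume Ω ^ (2 : ℝ)⁻¹).toNNReal * (L * A * (R * (3 * B))).toNNReal : ℝ≥0) *
          ENNReal.ofReal κ * ‖V‖ₑ := by
    obtain ⟨g', hg'c, hfg', hg'⟩ := hrep Ω f U V hUV
    -- The Lipschitz representative varies with the extension, but on the open set `Ω` all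
    -- continuous representatives agree, so the amplitudes do not.
    have heq : Set.EqOn g g' Ω := Measure.eqOn_open_of_ae_eq (hg.ae_eq.symm.trans hfg') hΩ
      hg.continuousOn hg'c.continuousOn
    have hbound : ∀ᵐ x ∂volume.restrict Ω, ‖f x - scaffold w μ S (fun k ↦ g (μ k)) x‖ ≤
        L * A * (R * (3 * B)) * κ * ‖V‖ := by
      filter_upwards [hg.ae_eq, ae_restrict_mem hΩ.measurableSet] with x hfx hx
      obtain ⟨k, hk⟩ := IsQuasiUniform.exists_edist_le_fillDistance (μ := μ) hK hx
      have hk' : ‖x - μ k‖ ≤ h := by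
        rw [← dist_eq_norm, dist_edist]
        exact ENNReal.toReal_mono hfin hk
      rw [hfx]
      calc _ ≤ L * ‖V‖ * ∑ k, shepardWeight w μ S k x * ‖x - μ k‖ := by
            refine norm_sub_scaffold_le hK hw0 _ _ _ fun k ↦ ?_
            rw [heq hx, heq (hμ.mem k)]
            exact hg' _ _
        _ ≤ L * ‖V‖ * (A * h) := by
            gcongr
            exact hsum hh hμ.fillDistance_div_le_dist hw hS x ⟨k, hk'⟩
        _ ≤ L * ‖V‖ * (A * (R * (3 * B) * κ)) := by gcongr
        _ = _ := by ring
    refine (eLpNorm_le_of_ae_bound hbound).trans_eq ?_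
    rw [Measure.restrict_apply_univ, ENNReal.toReal_ofNat, ENNReal.ofReal_mul (by positivity),
      ENNReal.ofReal_mul hM, ofReal_norm, ENNReal.coe_mul, ENNReal.coe_toNNReal hvol,
      ENNReal.ofReal]
    ring
  set Q : ℝ≥0∞ := ((volume Ω ^ (2 : ℝ)⁻¹).toNNReal * (L * A * (R * (3 * B))).toNNReal : ℝ≥0) *
    ENNReal.ofReal κ
  have hQ : Q ≠ ∞ := by finiteness
  -- Dividing by `Q` lets the infimum be bounded extension by extension; if `Q = 0`, one extension
  -- already shows that the error vanishes.
  rcases eq_or_ne Q 0 with hQ0 | hQ0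
  · obtain ⟨U, V, hUV⟩ := hf
    simpa only [hQ0, zero_mul] using key U V hUV
  · rw [← ENNReal.div_le_iff' hQ0 hQ]
    exact le_iInf fun U ↦ le_iInf₂ fun V hUV ↦ ENNReal.div_le_of_le_mul' (key U V hUV)
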